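/- Let $d\ge 1$ and $\tau\ge 2$ be integers, and let $C_1,\dots,C_\tau\subset\mathbb P^2_{\mathbb C}$ be smooth plane curves of degree $d$ such that the divisor $D=C_1+\dots+C_\tau$ is a transversal arrangement, i.e. $D$ is reduced and any two distinct components $C_i, C_j$ intersect transversally: at every common point their tangent lines are different. Let $t_\tau$ be the number of points of $\mathbb P^2$ through which all $\tau$ curves pass, and let $s$ be the number of points of $\mathbb P^2$ that lie on at least two of the curves. If $t_\tau=0$, then $$s\ \ge\ \tau .$$ -/

import Mathlib

open MvPolynomial
open scoped LinearAlgebra.Projectivization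

/-- A (possibly non-reduced) curve of degree `d` in the complex projective plane, given by a nonzero
homogeneous form of degree `d` in three variables. Two forms give the same curve exactly when they
are associated, i.e. when they differ by a nonzero constant. -/
structure PlaneCurve (d : ℕ) where
  form : MvPolynomial (Fin 3) ℂ
  isHomogeneous : form.IsHomogeneous d
  ne_zero : form ≠ 0

namespace PlaneCurve

variable {d : ℕ}

/-- The set of points of the curve. The choice of the representative vector `P.rep` is irrelevant,
see `PlaneCurve.mk_mem_points`. -/
def points (C : PlaneCurve d) : Set (ℙ ℂ (Fin 3 → ℂ)) :=
  {P | eval P.rep C.form = 0}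

theorem eval_smul_form (C : PlaneCurve d) (a : ℂ) (v : Fin 3 → ℂ) :
    eval (a • v) C.form = a ^ d * eval v C.form := by
  rw [eval_eq, eval_eq, Finset.mul_sum]
  refine Finset.sum_congr rfl fun m hm => ?_
  have h : m.degree = d := by
    have h1 := C.isHomogeneous (mem_support_iff.mp hm)
    rw [Finsupp.degree_eq_weight_one]; exact h1
  have h2 : ∏ i ∈ m.support, a ^ m i = a ^ d := by
    rw [Finset.prod_pow_eq_pow_sum, ← h, Finsupp.degree_apply]
  simp only [Pi.smul_apply, smul_eq_mul, mul_pow, Finset.prod_mul_distrib, h2]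
  ring

theorem mk_mem_points (C : PlaneCurve d) (v : Fin 3 → ℂ) (hv : v ≠ 0) :
    Projectivization.mk ℂ v hv ∈ C.points ↔ eval v C.form = 0 := by
  obtain ⟨a, ha⟩ := Projectivization.exists_smul_eq_mk_rep ℂ v hv
  have ha' : (a : ℂ) • v = (Projectivization.mk ℂ v hv).rep := ha
  simp only [points, Set.mem_ofPred_eq]
  rw [← ha', eval_smul_form]
  simp

/-- The gradient of the defining form at a vector. At a smooth point `[v]` of the curve it is the
coefficient vector of the equation of the projective tangent line. -/
noncomputable def gradient (C : PlaneCurve d) (v : Fin 3 → ℂ) : Fin 3 → ℂ :=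
  fun k => eval v (pderiv k C.form)

/-- Smoothness (Jacobian criterion): the gradient does not vanish at any point of the curve. -/
def IsSmooth (C : PlaneCurve d) : Prop :=
  ∀ v : Fin 3 → ℂ, v ≠ 0 → eval v C.form = 0 → C.gradient v ≠ 0

/-- Two plane curves intersect transversally: at every common point they are smooth and have
different tangent lines, i.e. their gradients are linearly independent. -/
def MeetsTransversally (C C' : PlaneCurve d) : Prop :=
  ∀ v : Fin 3 → ℂ, v ≠ 0 → eval v C.form = 0 → eval v C'.form = 0 →
    LinearIndependent ℂ ![C.gradient v, C'.gradient v]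

end PlaneCurve

/-- The divisor `C 0 + ⋯ + C (τ - 1)` of plane curves of degree `d` is a transversal arrangement. -/
structure IsTransversalArrangement {τ d : ℕ} (C : Fin τ → PlaneCurve d) : Prop where
  two_le : 2 ≤ τ
  /-- the divisor is reduced -/
  reduced : Squarefree (∏ i, (C i).form)
  smooth : ∀ i, (C i).IsSmooth
  transversal : ∀ i j, i ≠ j → (C i).MeetsTransversally (C j)

namespace PlaneArrangement

variable {τ d : ℕ}

/-- The set of intersection points of components. -/
def sing (C : Fin τ → PlaneCurve d) : Set (ℙ ℂ (Fin 3 → ℂ)) :=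
  {P | ∃ i j, i ≠ j ∧ P ∈ (C i).points ∧ P ∈ (C j).points}

/-- The number `s` of intersection points. -/
noncomputable def numSing (C : Fin τ → PlaneCurve d) : ℕ :=
  (sing C).ncard

/-- The number of components passing through `P`. -/
noncomputable def multiplicity (C : Fin τ → PlaneCurve d) (P : ℙ ℂ (Fin 3 → ℂ)) : ℕ :=
  {i | P ∈ (C i).points}.ncard

/-- The number `t_r` of `r`-fold points, for `r ≥ 2`. -/
noncomputable def numFold (C : Fin τ → PlaneCurve d) (r : ℕ) : ℕ :=
  {P | multiplicity C P = r}.ncard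

end PlaneArrangement

/-! Let `A i` be the set of points of `sing C` on the `i`-th curve. By Bézout, transversality makes
every `A i ∩ A j` with `i ≠ j` have exactly `d ^ 2` points. If some `A i` had at most `d ^ 2`
points, it would equal each of these intersections, so its points would lie on all curves, against
`t_τ = 0`. Hence every `A i` is larger than `d ^ 2`, and Fisher's inequality
(`card_le_card_of_card_inter_eq`) gives at least as many points as curves.

Bézout is proved by evaluating forms of degree `n` at the common points of `F` and `G`. For `n ≥ 2 *
d` the forms in `(F, G)` have codimension `d ^ 2` (`finrank_formsInIdeal_add_sq`). Evaluation kills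
them and is onto for large `n`, so there are at most `d ^ 2` points. Conversely its kernel lies in
`(F, G)`: in a chart `L = 1` containing all common points, transversality makes `(F, G, L - 1)`
radical; homogenizing puts `L ^ N * p` in `(F, G)`, and `L` cancels because it is not a zero divisor
modulo `(F, G)`. -/

namespace MvPolynomial

/-! ### Zeros, homogeneity and linear forms -/

variable {σ K : Type*} [Field K]

/-- A polynomial in at least two variables over an algebraically closed field which is not a unit
has a zero different from the origin. -/
theorem exists_ne_zero_eval_eq_zero_of_not_isUnit [IsAlgClosed K] [Finite σ] {i j : σ} (hij : i ≠ j)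
    {D : MvPolynomial σ K} (hD : ¬ IsUnit D) : ∃ v : σ → K, v ≠ 0 ∧ eval v D = 0 := by
  by_contra! h
  -- Nullstellensatz: if the origin is the only possible zero, every variable lies in the radical of
  -- `(D)`. Then `D` divides powers of two coprime variables.
  have key : ∀ k : σ, ∃ n : ℕ, D ∣ (X k : MvPolynomial σ K) ^ n := by
    intro k
    have : (X k : MvPolynomial σ K) ∈ (Ideal.span {D}).radical := by
      rw [← vanishingIdeal_zeroLocus_eq_radical (K := K)]
      intro x hx
      have hx0 : x = 0 := by
        by_contra hne
        exact h x hne (by simpa [aeval_eq_eval] using hx D (Ideal.mem_span_singleton_self D))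
      simp [hx0]
    obtain ⟨n, hn⟩ := this
    exact ⟨n, Ideal.mem_span_singleton.1 hn⟩
  obtain ⟨n, hn⟩ := key i
  obtain ⟨m, hm⟩ := key j
  have hrel : IsRelPrime (X i : MvPolynomial σ K) (X j) := by
    rw [(X_prime (R := K) (i := i)).irreducible.isRelPrime_iff_not_dvd]
    simpa using hij
  exact hD (hrel.pow hn hm)

theorem IsHomogeneous.aeval_smul {A : Type*} [CommRing A] [Algebra K A] {q : MvPolynomial σ K}
    {n : ℕ} (hq : q.IsHomogeneous n) (c : A) (x : σ → A) :
    MvPolynomial.aeval (c • x) q = c ^ n * MvPolynomial.aeval x q := by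
  rw [aeval_def, aeval_def, eval₂_eq, eval₂_eq, Finset.mul_sum]
  refine Finset.sum_congr rfl fun m hm => ?_
  have h : m.degree = n := by
    have h1 := hq (mem_support_iff.mp hm)
    rw [Finsupp.degree_eq_weight_one]; exact h1
  have h2 : ∏ i ∈ m.support, c ^ m i = c ^ n := by
    rw [Finset.prod_pow_eq_pow_sum, ← h, Finsupp.degree_apply]
  simp only [Pi.smul_apply, smul_eq_mul, mul_pow, Finset.prod_mul_distrib, h2]
  ring

theorem IsHomogeneous.eval_smul {q : MvPolynomial σ K}
    {n : ℕ} (hq : q.IsHomogeneous n) (c : K) (x : σ → K) :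
    eval (c • x) q = c ^ n * eval x q := by
  simpa [aeval_eq_eval] using hq.aeval_smul c x

/-- The linear form with coefficient vector `a`. -/
noncomputable def linearForm [Fintype σ] (a : σ → K) : MvPolynomial σ K :=
  ∑ k, C (a k) * X k

theorem isHomogeneous_linearForm [Fintype σ] (a : σ → K) : (linearForm a).IsHomogeneous 1 :=
  IsHomogeneous.sum _ _ _ fun _ _ => isHomogeneous_C_mul_X _ _

theorem eval_linearForm [Fintype σ] (a v : σ → K) : eval v (linearForm a) = ∑ k, a k * v k := by
  simp [linearForm]

theorem exists_eval_linearForm_eq [Fintype σ] (f : Module.Dual K (σ → K)) :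
    ∃ a, ∀ v, eval v (linearForm a) = f v := by
  classical
  refine ⟨fun k => f (Pi.single k 1), fun v => ?_⟩
  rw [eval_linearForm]
  conv_rhs => rw [← Finset.univ_sum_single v, map_sum]
  refine Finset.sum_congr rfl fun k _ => ?_
  have : Pi.single k (v k) = v k • (Pi.single k 1 : σ → K) := by
    rw [← Pi.single_smul]; simp
  rw [this, map_smul, smul_eq_mul, mul_comm]

section

attribute [local instance] MvPolynomial.gradedAlgebra

theorem homogeneousComponent_mul_of_isHomogeneous_right (a : MvPolynomial σ K)
    {f : MvPolynomial σ K} {d : ℕ} (hf : f.IsHomogeneous d) (n : ℕ) :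
    homogeneousComponent (n + d) (a * f) = homogeneousComponent n a * f := by
  have h := DirectSum.coe_decompose_mul_of_right_mem_of_le (𝒜 := homogeneousSubmodule σ K)
    (a := a) (b := f) (i := d) (n := n + d) hf (by omega)
  rw [Nat.add_sub_cancel] at h
  rw [← decomposition.decompose'_apply, ← decomposition.decompose'_apply]
  exact h

end

/-- Compare components of degree `n + d` and cancel `f`. -/
theorem IsHomogeneous.of_mul_right {a f : MvPolynomial σ K} {n d : ℕ} (hf : f.IsHomogeneous d)
    (hf0 : f ≠ 0) (h : (a * f).IsHomogeneous (n + d)) : a.IsHomogeneous n := by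
  have h1 := homogeneousComponent_mul_of_isHomogeneous_right a hf n
  rw [homogeneousComponent_eq_self h] at h1
  rw [mul_right_cancel₀ hf0 h1]
  exact homogeneousComponent_isHomogeneous n a

/-! ### Jacobian criterion for a radical ideal -/

/-- A polynomial vanishing at `v` is a combination of the `X k - v k`, the coefficients having the
partial derivatives as their values at `v`. -/
theorem exists_eq_sum_mul_X_sub_C [Fintype σ] (p : MvPolynomial σ K) (v : σ → K)
    (hp : eval v p = 0) : ∃ b : σ → MvPolynomial σ K,
      p = ∑ k, b k * (X k - C (v k)) ∧ ∀ k, eval v (b k) = eval v (pderiv k p) := by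
  classical
  set M : Ideal (MvPolynomial σ K) := Ideal.span (Set.range fun k => X k - C (v k)) with hM
  have h1 : (Ideal.Quotient.mkₐ K M) =
      (Algebra.ofId K (MvPolynomial σ K ⧸ M)).comp (aeval v) := by
    ext k
    simp only [Ideal.Quotient.mkₐ_eq_mk, AlgHom.comp_apply, aeval_X]
    change Ideal.Quotient.mk M (X k) = Ideal.Quotient.mk M (C (v k))
    rw [Ideal.Quotient.eq]
    exact Ideal.subset_span ⟨k, rfl⟩
  have h2 : p ∈ M := by
    rw [← Ideal.Quotient.eq_zero_iff_mem, ← Ideal.Quotient.mkₐ_eq_mk K, h1]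
    simp [aeval_eq_eval, hp]
  obtain ⟨b, hb⟩ := (Ideal.mem_span_range_iff_exists_fun).1 h2
  refine ⟨b, hb.symm, fun k => ?_⟩
  rw [← hb]
  simp only [map_sum, Derivation.leibniz, smul_eq_mul, map_add, map_mul, map_sub, eval_X, eval_C,
    sub_self, zero_mul, add_zero, pderiv_C, sub_zero, pderiv_X]
  rw [Finset.sum_eq_single k] <;> simp +contextual [eq_comm]

/-- If the Jacobian determinant of `f` does not vanish at the common zeros of `f`, then the ideal
generated by `f` is its own vanishing ideal. -/
theorem mem_span_range_of_forall_eval_eq_zero [IsAlgClosed K] [Fintype σ] [DecidableEq σ]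
    (f : σ → MvPolynomial σ K)
    (hf : ∀ v, (∀ i, eval v (f i) = 0) →
      (Matrix.of fun i k => eval v (pderiv k (f i))).det ≠ 0)
    (p : MvPolynomial σ K) (hp : ∀ v, (∀ i, eval v (f i) = 0) → eval v p = 0) :
    p ∈ Ideal.span (Set.range f) := by
  set J := Ideal.span (Set.range f) with hJ
  by_contra hpJ
  -- If `p ∉ J`, this colon ideal is proper, so it lies in the maximal ideal of a point `v`, which
  -- is then a common zero of `f`.
  let Q : Ideal (MvPolynomial σ K) := J.colon {p}
  have memQ : ∀ q, q ∈ Q ↔ q * p ∈ J := fun q => by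
    simp [Q, Submodule.mem_colon_singleton]
  have hQ : Q ≠ ⊤ := by
    intro h
    apply hpJ
    have : (1 : MvPolynomial σ K) ∈ Q := by rw [h]; trivial
    simpa using (memQ 1).1 this
  obtain ⟨M, hM, hQM⟩ := Ideal.exists_le_maximal Q hQ
  obtain ⟨v, rfl⟩ := isMaximal_iff_eq_vanishingIdeal_singleton.1 hM
  have memM : ∀ q, q ∈ vanishingIdeal K {v} ↔ eval v q = 0 := fun q => by
    rw [mem_vanishingIdeal_singleton_iff, aeval_eq_eval]
  have hv : ∀ i, eval v (f i) = 0 := fun i =>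
    (memM _).1 (hQM ((memQ _).2 (J.mul_mem_right _ (Ideal.subset_span ⟨i, rfl⟩))))
  choose b hb hb' using fun i => exists_eq_sum_mul_X_sub_C (f i) v (hv i)
  obtain ⟨a, ha, -⟩ := exists_eq_sum_mul_X_sub_C p v (hp v hv)
  let B : Matrix σ σ (MvPolynomial σ K) := Matrix.of b
  have hBy : B.mulVec (fun k => X k - C (v k)) = f := by
    ext1 i
    rw [hb i]; rfl
  -- Cramer's rule for `f = B (X - v)`. As `p` is a combination of the `X k - C (v k)`, `B.det` lies
  -- in `Q` and vanishes at `v`; but its value there is the Jacobian determinant.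
  have hdet : ∀ k, B.det * (X k - C (v k)) ∈ J := by
    intro k
    have h1 : B.adjugate.mulVec f = B.det • (fun k => X k - C (v k)) := by
      rw [← hBy, Matrix.mulVec_mulVec, Matrix.adjugate_mul, Matrix.smul_mulVec, Matrix.one_mulVec]
    have h2 := congrFun h1 k
    simp only [Pi.smul_apply, smul_eq_mul] at h2
    rw [← h2]
    exact Ideal.sum_mem _ fun i _ => J.mul_mem_left _ (Ideal.subset_span ⟨i, rfl⟩)
  have hdQ : B.det ∈ Q := by
    rw [memQ, ha, Finset.mul_sum]
    refine Ideal.sum_mem _ fun k _ => ?_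
    rw [mul_left_comm]
    exact J.mul_mem_left _ (hdet k)
  have := (memM _).1 (hQM hdQ)
  rw [RingHom.map_det] at this
  refine hf v hv ?_
  rw [← this]
  congr 1
  ext i k
  simp [B, hb']

/-! ### Homogenization and cancellation of a linear form -/

/-- Homogenization: membership in the ideal of the affine chart `L = 1`. -/
theorem exists_pow_mul_mem_span_pair {F G L p : MvPolynomial σ K} {d e n : ℕ}
    (hF : F.IsHomogeneous d) (hG : G.IsHomogeneous e) (hL : L.IsHomogeneous 1) (hL0 : L ≠ 0)
    (hp : p.IsHomogeneous n) {a b c : MvPolynomial σ K}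
    (h : p = a * F + b * G + c * (L - 1)) :
    ∃ N, L ^ N * p ∈ Ideal.span {F, G} := by
  let A := FractionRing (MvPolynomial σ K)
  let φ : MvPolynomial σ K →ₐ[K] A := IsScalarTower.toAlgHom K _ A
  have hφ : Function.Injective φ := IsFractionRing.injective (MvPolynomial σ K) A
  have hφL : φ L ≠ 0 := fun h0 => hL0 (hφ (by rw [h0, map_zero]))
  -- Dehomogenization `X k ↦ X k / L`: it kills `L - 1` and divides a form of degree `m` by `L ^ m`.
  let θ : MvPolynomial σ K →ₐ[K] A := aeval fun k => φ (X k) / φ L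
  have key : ∀ {q : MvPolynomial σ K} {m : ℕ}, q.IsHomogeneous m → φ q = φ L ^ m * θ q := by
    intro q m hq
    rw [← hq.aeval_smul]
    have : (φ L • fun k => φ (X k) / φ L) = fun k => φ (X k) := by
      ext k
      rw [Pi.smul_apply, smul_eq_mul, mul_div_assoc', mul_div_cancel_left₀ _ hφL]
    rw [this]
    exact DFunLike.congr_fun (f := φ) (g := aeval fun k => φ (X k)) (by ext; simp) q
  have hθL : θ L = 1 := by
    have := key hL
    rw [pow_one] at this
    exact (mul_left_cancel₀ hφL (by rw [mul_one]; exact this)).symm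
  have clear : ∀ q : MvPolynomial σ K, ∃ N, ∀ M ≥ N, ∃ r, φ r = φ L ^ M * θ q := by
    intro q
    refine ⟨q.totalDegree, fun M hM => ⟨∑ i ∈ Finset.range (q.totalDegree + 1),
      L ^ (M - i) * homogeneousComponent i q, ?_⟩⟩
    conv_rhs => rw [← sum_homogeneousComponent q]
    rw [map_sum, map_sum, Finset.mul_sum]
    refine Finset.sum_congr rfl fun i hi => ?_
    have hi' : i ≤ M := by have := Finset.mem_range.1 hi; omega
    rw [map_mul, map_pow, key (homogeneousComponent_isHomogeneous i q), ← mul_assoc, ← pow_add,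
      Nat.sub_add_cancel hi']
  obtain ⟨Na, ha⟩ := clear a
  obtain ⟨Nb, hb⟩ := clear b
  -- The extra `e` here and `d` below balance the degrees of `F` and `G`, giving both terms the same
  -- power of `L`.
  obtain ⟨a', ha'⟩ := ha (Na + Nb + e) (by omega)
  obtain ⟨b', hb'⟩ := hb (Na + Nb + d) (by omega)
  refine ⟨Na + Nb + d + e, Ideal.mem_span_pair.2 ⟨L ^ n * a', L ^ n * b', hφ ?_⟩⟩
  simp only [map_add, map_mul, map_pow, ha', hb', key hF, key hG, key hp]
  have h' : θ p = θ a * θ F + θ b * θ G := by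
    rw [h]; simp [hθL]
  rw [h']
  ring

end MvPolynomial

/-- The syzygies of two coprime elements. -/
theorem IsRelPrime.exists_eq_mul_of_mul_add_mul_eq_zero {R : Type*} [CommRing R] [IsDomain R]
    [DecompositionMonoid R] {f g a b : R} (h : IsRelPrime f g) (hg : g ≠ 0)
    (hab : a * f + b * g = 0) : ∃ c, a = c * g ∧ b = -(c * f) := by
  have h1 : g ∣ a * f := ⟨-b, by linear_combination hab⟩
  obtain ⟨c, rfl⟩ := h.symm.dvd_of_dvd_mul_right h1
  refine ⟨c, mul_comm _ _, mul_right_cancel₀ hg ?_⟩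
  linear_combination hab

/-- If `F` and `G` become coprime modulo `L`, then `L` is not a zero divisor modulo `(F, G)`. -/
theorem Ideal.mem_span_pair_of_mul_mem {R T : Type*} [CommRing R] [IsDomain R] [CommRing T]
    [IsDomain T] [DecompositionMonoid T] (π : R →+* T) (hπ : Function.Surjective π) {F G L : R}
    (hL0 : L ≠ 0) (hker : ∀ x, π x = 0 ↔ L ∣ x) (hrel : IsRelPrime (π F) (π G)) (hG : π G ≠ 0)
    {h : R} (hh : L * h ∈ Ideal.span {F, G}) : h ∈ Ideal.span {F, G} := by
  obtain ⟨a, b, hab⟩ := Ideal.mem_span_pair.1 hh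
  have hL : π L = 0 := (hker L).2 dvd_rfl
  have h0 : π a * π F + π b * π G = 0 := by
    rw [← map_mul, ← map_mul, ← map_add, hab, map_mul, hL, zero_mul]
  -- Modulo `L`, `(a, b)` is the Koszul syzygy `c * (G, -F)`; subtracting a lift of it leaves
  -- coefficients divisible by `L`.
  obtain ⟨c, hc1, hc2⟩ := hrel.exists_eq_mul_of_mul_add_mul_eq_zero hG h0
  obtain ⟨c, rfl⟩ := hπ c
  obtain ⟨a', ha'⟩ := (hker (a - c * G)).1 (by rw [map_sub, map_mul, hc1, sub_self])
  obtain ⟨b', hb'⟩ := (hker (b + c * F)).1 (by rw [map_add, map_mul, hc2, neg_add_cancel])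
  refine Ideal.mem_span_pair.2 ⟨a', b', mul_left_cancel₀ hL0 ?_⟩
  linear_combination hab - F * ha' - G * hb'

/-! ### Hilbert function, evaluation and the upper bound -/

namespace MvPolynomial

variable {σ K : Type*} [Field K]

instance finite_homogeneousSubmodule [Finite σ] (n : ℕ) :
    Module.Finite K (homogeneousSubmodule σ K n) :=
  Module.Finite.iff_fg.2 (homogeneousSubmodule_fg σ K n)

theorem finrank_homogeneousSubmodule_fin_three_mul_two (n : ℕ) :
    Module.finrank K (homogeneousSubmodule (Fin 3) K n) * 2 = (n + 2) * (n + 1) := by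
  have hset : {d : Fin 3 →₀ ℕ | d.degree = n} =
      ((Finset.univ : Finset (Fin 3)).finsuppAntidiag n : Set (Fin 3 →₀ ℕ)) := by
    ext f
    simp [Finset.mem_finsuppAntidiag, Finsupp.degree_eq_sum]
  have h1 : Module.finrank K (homogeneousSubmodule (Fin 3) K n) = (n + 2).choose 2 := by
    rw [homogeneousSubmodule_eq_finsupp_supported, hset]
    rw [(AddMonoidAlgebra.supportedEquivFinsupp _).finrank_eq, Module.finrank_finsupp_self]
    simp only [Finset.coe_sort_coe, Fintype.card_coe]
    rw [Finset.card_finsuppAntidiag_nat_eq_choose, Finset.card_univ, Fintype.card_fin,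
      show 3 + n - 1 = n + 2 by omega, Nat.choose_symm_add]
  rw [h1, Nat.choose_two_right, Nat.div_mul_cancel (Nat.even_mul_pred_self _).two_dvd]
  rfl

/-- The forms of degree `n` in the ideal `(F, G)`. -/
noncomputable def formsInIdeal (F G : MvPolynomial σ K) (n : ℕ) :
    Submodule K (MvPolynomial σ K) :=
  homogeneousSubmodule σ K n ⊓ (Ideal.span {F, G}).restrictScalars K

theorem mem_formsInIdeal {F G p : MvPolynomial σ K} {n : ℕ} :
    p ∈ formsInIdeal F G n ↔ p.IsHomogeneous n ∧ p ∈ Ideal.span {F, G} := Iff.rfl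

/-- Coefficients may be replaced by their components of degree `m`. -/
theorem mem_formsInIdeal_add_iff {F G p : MvPolynomial σ K} {d m : ℕ} (hF : F.IsHomogeneous d)
    (hG : G.IsHomogeneous d) : p ∈ formsInIdeal F G (m + d) ↔
      ∃ a b, a.IsHomogeneous m ∧ b.IsHomogeneous m ∧ a * F + b * G = p := by
  rw [mem_formsInIdeal]
  constructor
  · rintro ⟨hp, hI⟩
    obtain ⟨a, b, hab⟩ := Ideal.mem_span_pair.1 hI
    refine ⟨_, _, homogeneousComponent_isHomogeneous m a,
      homogeneousComponent_isHomogeneous m b, ?_⟩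
    rw [← homogeneousComponent_mul_of_isHomogeneous_right a hF,
      ← homogeneousComponent_mul_of_isHomogeneous_right b hG, ← map_add, hab,
      homogeneousComponent_eq_self hp]
  · rintro ⟨a, b, ha, hb, rfl⟩
    exact ⟨(ha.mul hF).add (hb.mul hG), Ideal.mem_span_pair.2 ⟨a, b, rfl⟩⟩

/-- The Hilbert function of a complete intersection of two plane curves of degree `d`. -/
theorem finrank_formsInIdeal_add_sq {F G : MvPolynomial (Fin 3) K} {d : ℕ}
    (hF : F.IsHomogeneous d) (hG : G.IsHomogeneous d) (hG0 : G ≠ 0) (hrel : IsRelPrime F G)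
    (k : ℕ) : Module.finrank K (formsInIdeal F G (k + d + d)) + d ^ 2 =
      Module.finrank K (homogeneousSubmodule (Fin 3) K (k + d + d)) := by
  let φ : (homogeneousSubmodule (Fin 3) K (k + d)) × (homogeneousSubmodule (Fin 3) K (k + d)) →ₗ[K]
      MvPolynomial (Fin 3) K :=
    ((LinearMap.mulRight K F).domRestrict _).coprod ((LinearMap.mulRight K G).domRestrict _)
  have hφ : ∀ a b, φ (a, b) = a.1 * F + b.1 * G := fun a b => rfl
  have hrange : LinearMap.range φ = formsInIdeal F G (k + d + d) := by
    ext p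
    rw [mem_formsInIdeal_add_iff hF hG, LinearMap.mem_range]
    constructor
    · rintro ⟨⟨a, b⟩, rfl⟩
      exact ⟨a, b, a.2, b.2, rfl⟩
    · rintro ⟨a, b, ha, hb, rfl⟩
      exact ⟨(⟨a, ha⟩, ⟨b, hb⟩), rfl⟩
  -- The Koszul map, whose range is the kernel of `φ`. The codimension is thus the second
  -- difference, with step `d`, of `(n + 2) * (n + 1) / 2`, namely `d ^ 2`.
  let ψ : homogeneousSubmodule (Fin 3) K k →ₗ[K]
      (homogeneousSubmodule (Fin 3) K (k + d)) × (homogeneousSubmodule (Fin 3) K (k + d)) :=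
    (((LinearMap.mulRight K G).domRestrict _).codRestrict _ fun c => IsHomogeneous.mul c.2 hG).prod
      (-(((LinearMap.mulRight K F).domRestrict _).codRestrict _ fun c => IsHomogeneous.mul c.2 hF))
  have hψinj : Function.Injective ψ := by
    intro c c' h
    have h1 := congrArg (fun x => (x.1 : MvPolynomial (Fin 3) K)) h
    exact Subtype.ext (mul_right_cancel₀ hG0 h1)
  have hker : LinearMap.ker φ = LinearMap.range ψ := by
    ext ⟨a, b⟩
    rw [LinearMap.mem_ker, LinearMap.mem_range, hφ]
    constructor
    · intro h
      obtain ⟨c, hc1, hc2⟩ := hrel.exists_eq_mul_of_mul_add_mul_eq_zero hG0 h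
      have ha := a.2
      rw [mem_homogeneousSubmodule, hc1] at ha
      exact ⟨⟨c, IsHomogeneous.of_mul_right hG hG0 ha⟩, Prod.ext (Subtype.ext hc1.symm) (Subtype.ext hc2.symm)⟩
    · rintro ⟨c, hc⟩
      have h1 : c.1 * G = a := congrArg (fun x => (x.1 : MvPolynomial (Fin 3) K)) hc
      have h2 : -(c.1 * F) = b := congrArg (fun x => (x.2 : MvPolynomial (Fin 3) K)) hc
      rw [← h1, ← h2]
      ring
  have hdim := LinearMap.finrank_range_add_finrank_ker φ
  rw [hrange, hker, LinearMap.finrank_range_of_inj hψinj, Module.finrank_prod] at hdim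
  have h0 := finrank_homogeneousSubmodule_fin_three_mul_two (K := K) k
  have h1 := finrank_homogeneousSubmodule_fin_three_mul_two (K := K) (k + d)
  have h2 := finrank_homogeneousSubmodule_fin_three_mul_two (K := K) (k + d + d)
  zify at *
  linarith

/-- Evaluation of forms of degree `n` at finitely many vectors. -/
noncomputable def evalForms {ι : Type*} (v : ι → σ → K) (n : ℕ) :
    homogeneousSubmodule σ K n →ₗ[K] ι → K :=
  (LinearMap.pi fun i => (aeval (v i)).toLinearMap) ∘ₗ (homogeneousSubmodule σ K n).subtype

theorem evalForms_apply {ι : Type*} (v : ι → σ → K) (n : ℕ) (p : homogeneousSubmodule σ K n)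
    (i : ι) : evalForms v n p i = eval (v i) p.1 := by
  simp [evalForms, aeval_eq_eval]

/-- Pairwise non-proportional vectors are separated by the forms of large degree. -/
theorem exists_isHomogeneous_eval_ne_zero {ι : Type*} [Fintype ι] [Fintype σ] {v : ι → σ → K}
    (hv0 : ∀ i, v i ≠ 0) (hv : Pairwise fun i j => LinearIndependent K ![v i, v j]) (i : ι)
    (n : ℕ) : ∃ p : MvPolynomial σ K, p.IsHomogeneous (n + Fintype.card ι) ∧ eval (v i) p ≠ 0 ∧
      ∀ j ≠ i, eval (v j) p = 0 := by
  classical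
  have key : ∀ j, ∃ a : σ → K, eval (v i) (linearForm a) ≠ 0 ∧
      (j ≠ i → eval (v j) (linearForm a) = 0) := by
    intro j
    by_cases hij : j = i
    · obtain ⟨f, hf⟩ : ∃ f : Module.Dual K (σ → K), f (v i) ≠ 0 := by
        by_contra! h
        exact hv0 i ((Module.forall_dual_apply_eq_zero_iff K (v i)).1 h)
      obtain ⟨a, ha⟩ := exists_eval_linearForm_eq f
      exact ⟨a, by rw [ha]; exact hf, fun h => absurd hij h⟩
    · have hnot : v i ∉ Submodule.span K {v j} := by
        rw [Submodule.mem_span_singleton]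
        rintro ⟨c, hc⟩
        have := LinearIndependent.pair_iff.1 (hv (Ne.symm hij)) 1 (-c) (by simp [← hc])
        exact one_ne_zero this.1
      obtain ⟨f, hf1, hf2⟩ := Submodule.exists_dual_map_eq_bot_of_notMem hnot inferInstance
      obtain ⟨a, ha⟩ := exists_eval_linearForm_eq f
      refine ⟨a, by rw [ha]; exact hf1, fun _ => ?_⟩
      rw [ha]
      have : f (v j) ∈ (Submodule.span K {v j}).map f :=
        Submodule.mem_map_of_mem (Submodule.mem_span_singleton_self _)
      rwa [hf2, Submodule.mem_bot] at this
  choose a ha ha' using key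
  -- All factors avoid `v i`, the `j`-th one passes through `v j` for `j ≠ i`, and the power adjusts
  -- the degree.
  refine ⟨linearForm (a i) ^ n * ∏ j, linearForm (a j), ?_, ?_, fun j hj => ?_⟩
  · have h1 := (isHomogeneous_linearForm (a i)).pow n
    have h2 := IsHomogeneous.prod Finset.univ (fun j => linearForm (a j)) (fun _ => 1)
      fun j _ => isHomogeneous_linearForm (a j)
    simpa using h1.mul h2
  · rw [map_mul, map_pow, map_prod]
    exact mul_ne_zero (pow_ne_zero _ (ha i)) (Finset.prod_ne_zero_iff.2 fun j _ => ha j)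
  · rw [map_mul, map_prod, Finset.prod_eq_zero (Finset.mem_univ j) (ha' j hj), mul_zero]

theorem evalForms_surjective {ι : Type*} [Fintype ι] [Fintype σ] {v : ι → σ → K}
    (hv0 : ∀ i, v i ≠ 0) (hv : Pairwise fun i j => LinearIndependent K ![v i, v j]) (n : ℕ) :
    Function.Surjective (evalForms v (n + Fintype.card ι)) := by
  classical
  choose p hp hp1 hp2 using fun i => exists_isHomogeneous_eval_ne_zero hv0 hv i n
  intro f
  refine ⟨∑ i, (f i / eval (v i) (p i)) • ⟨p i, hp i⟩, ?_⟩
  ext j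
  rw [map_sum, Finset.sum_apply, Finset.sum_eq_single j]
  · rw [map_smul, Pi.smul_apply, evalForms_apply, smul_eq_mul, div_mul_cancel₀ _ (hp1 j)]
  · intro i _ hij
    rw [map_smul, Pi.smul_apply, evalForms_apply, hp2 i j hij.symm, smul_zero]
  · simp

/-- Two plane curves of degree `d` without common component have at most `d ^ 2` common points. -/
theorem card_le_sq_of_isRelPrime {ι : Type*} [Fintype ι] {F G : MvPolynomial (Fin 3) K} {d : ℕ}
    (hF : F.IsHomogeneous d) (hG : G.IsHomogeneous d) (hG0 : G ≠ 0) (hrel : IsRelPrime F G)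
    {v : ι → Fin 3 → K} (hv0 : ∀ i, v i ≠ 0)
    (hv : Pairwise fun i j => LinearIndependent K ![v i, v j]) (hvF : ∀ i, eval (v i) F = 0)
    (hvG : ∀ i, eval (v i) G = 0) : Fintype.card ι ≤ d ^ 2 := by
  obtain ⟨k, hk⟩ : ∃ k, k = Fintype.card ι := ⟨_, rfl⟩
  have hsurj := evalForms_surjective hv0 hv (d + d)
  rw [show d + d + Fintype.card ι = k + d + d by omega] at hsurj
  have h1 := LinearMap.finrank_range_add_finrank_ker (evalForms v (k + d + d))
  rw [LinearMap.range_eq_top.2 hsurj, finrank_top, Module.finrank_fintype_fun_eq_card,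
    ← finrank_formsInIdeal_add_sq hF hG hG0 hrel] at h1
  have h2 : (formsInIdeal F G (k + d + d)).comap (homogeneousSubmodule (Fin 3) K _).subtype ≤
      LinearMap.ker (evalForms v (k + d + d)) := by
    intro p hp
    obtain ⟨a, b, hab⟩ := Ideal.mem_span_pair.1 (mem_formsInIdeal.1 hp).2
    rw [LinearMap.mem_ker]
    ext i
    rw [evalForms_apply]
    change a * F + b * G = p.1 at hab
    simp [← hab, hvF, hvG]
  have h3 := Submodule.finrank_mono h2
  rw [(Submodule.comapSubtypeEquivOfLe (show formsInIdeal F G (k + d + d) ≤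
    homogeneousSubmodule (Fin 3) K _ from inf_le_left)).finrank_eq] at h3
  omega

/-! ### Transversality and the lower bound -/

/-- Forms with linearly independent gradients at their common zeros are coprime. -/
theorem isRelPrime_of_linearIndependent_gradient [IsAlgClosed K] [Finite σ] [Nontrivial σ]
    {F G : MvPolynomial σ K}
    (h : ∀ v : σ → K, v ≠ 0 → eval v F = 0 → eval v G = 0 →
      LinearIndependent K ![fun k => eval v (pderiv k F), fun k => eval v (pderiv k G)]) :
    IsRelPrime F G := by
  rintro D ⟨a, rfl⟩ ⟨b, rfl⟩
  by_contra hD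
  obtain ⟨i, j, hij⟩ := exists_pair_ne σ
  obtain ⟨v, hv0, hv⟩ := exists_ne_zero_eval_eq_zero_of_not_isUnit hij hD
  have h1 := h v hv0 (by simp [hv]) (by simp [hv])
  -- At a zero of `D` the gradients of `D * a` and `D * b` are `a` and `b` times that of `D`, hence
  -- proportional.
  have h2 := LinearIndependent.pair_iff.1 h1 (eval v b) (-eval v a) (by
    ext k
    simp [Derivation.leibniz, hv]
    ring)
  apply h1.ne_zero 0
  ext k
  simp [Derivation.leibniz, hv, neg_eq_zero.1 h2.2]

/-- A linear form without zeros in common with `F` and `G` is not a zero divisor modulo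
`(F, G)`. -/
theorem mem_span_pair_of_linearForm_mul_mem [IsAlgClosed K] {F G h : MvPolynomial (Fin 3) K}
    {d : ℕ} (hd : d ≠ 0) (hF : F.IsHomogeneous d) {ℓ : Fin 3 → K} (hℓ : ℓ 2 ≠ 0)
    (hℓFG : ∀ v : Fin 3 → K, v ≠ 0 → eval v F = 0 → eval v G = 0 → eval v (linearForm ℓ) ≠ 0)
    (hh : linearForm ℓ * h ∈ Ideal.span {F, G}) : h ∈ Ideal.span {F, G} := by
  have hLeq : (linearForm ℓ : MvPolynomial (Fin 3) K) =
      C (ℓ 0) * X 0 + C (ℓ 1) * X 1 + C (ℓ 2) * X 2 := by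
    simp [linearForm, Fin.sum_univ_three]
  have hCℓ : (C (ℓ 2) * C (ℓ 2)⁻¹ : MvPolynomial (Fin 3) K) = 1 := by
    rw [← C_mul, mul_inv_cancel₀ hℓ, C_1]
  have hCℓ' : (C (ℓ 2) * C (ℓ 2)⁻¹ : MvPolynomial (Fin 2) K) = 1 := by
    rw [← C_mul, mul_inv_cancel₀ hℓ, C_1]
  -- Restriction to the line `L = 0`, eliminating `X 2`. Without common zeros there, the restricted
  -- forms are coprime.
  let π : MvPolynomial (Fin 3) K →ₐ[K] MvPolynomial (Fin 2) K :=
    aeval ![X 0, X 1, -(C (ℓ 2)⁻¹ * (C (ℓ 0) * X 0 + C (ℓ 1) * X 1))]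
  let ι : MvPolynomial (Fin 2) K →ₐ[K] MvPolynomial (Fin 3) K := aeval ![X 0, X 1]
  have hπι : ∀ q, π (ι q) = q := by
    intro q
    refine DFunLike.congr_fun (f := π.comp ι) (g := AlgHom.id K _) ?_ q
    ext k
    fin_cases k <;> simp [π, ι]
  have hπL : π (linearForm ℓ) = 0 := by
    rw [hLeq]
    simp only [π, map_add, map_mul, aeval_X, aeval_C, algebraMap_eq, Matrix.cons_val]
    linear_combination -(C (ℓ 0) * X 0 + C (ℓ 1) * X 1) * hCℓ'
  have hker : ∀ x, π x = 0 ↔ linearForm ℓ ∣ x := by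
    intro x
    constructor
    · intro hx
      have h1 : (Ideal.Quotient.mkₐ K (Ideal.span {linearForm ℓ})) =
          ((Ideal.Quotient.mkₐ K (Ideal.span {linearForm ℓ})).comp ι).comp π := by
        ext k
        simp only [AlgHom.comp_apply, Ideal.Quotient.mkₐ_eq_mk]
        rw [Ideal.Quotient.eq, Ideal.mem_span_singleton]
        fin_cases k
        · simp [π, ι]
        · simp [π, ι]
        · refine ⟨C (ℓ 2)⁻¹, ?_⟩
          rw [hLeq]
          simp only [Fin.reduceFinMk, π, ι, map_add, map_mul, map_neg, aeval_X, aeval_C,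
            algebraMap_eq, Matrix.cons_val]
          linear_combination -X 2 * hCℓ
      rw [← Ideal.mem_span_singleton, ← Ideal.Quotient.eq_zero_iff_mem,
        ← Ideal.Quotient.mkₐ_eq_mk K, h1, AlgHom.comp_apply, hx, map_zero]
    · rintro ⟨y, rfl⟩
      rw [map_mul, hπL, zero_mul]
  have hzero : ∀ (w : Fin 2 → K), w ≠ 0 → eval w (π F) = 0 → eval w (π G) ≠ 0 := by
    intro w hw hwF hwG
    let v : Fin 3 → K := fun k => eval w (π (X k))
    have hev : ∀ q, eval w (π q) = eval v q := by
      intro q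
      rw [← aeval_eq_eval, ← aeval_eq_eval]
      refine DFunLike.congr_fun (f := (aeval w).comp π) (g := aeval v) ?_ q
      ext k
      simp [v, aeval_eq_eval]
    refine hℓFG v ?_ (by rw [← hev, hwF]) (by rw [← hev, hwG]) (by rw [← hev, hπL, map_zero])
    intro hv
    apply hw
    ext k
    fin_cases k
    · simpa [v, π] using congrFun hv 0
    · simpa [v, π] using congrFun hv 1
  have hrel : IsRelPrime (π F) (π G) := by
    rintro D ⟨a, ha⟩ ⟨b, hb⟩
    by_contra hD
    obtain ⟨w, hw0, hw⟩ := exists_ne_zero_eval_eq_zero_of_not_isUnit (zero_ne_one (α := Fin 2)) hD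
    exact hzero w hw0 (by simp [ha, hw]) (by simp [hb, hw])
  -- Since `d ≠ 0`, `π F` is not a unit; coprimality then excludes `π G = 0`.
  have hπF0 : eval 0 (π F) = 0 := by
    have h1 : (π F).IsHomogeneous (1 * d) := by
      refine hF.aeval _ fun k => ?_
      fin_cases k
      · exact isHomogeneous_X _ _
      · exact isHomogeneous_X _ _
      · exact (((isHomogeneous_C_mul_X _ _).add (isHomogeneous_C_mul_X _ _)).C_mul _).neg
    have h2 := h1.eval_smul 0 0
    rwa [zero_smul, one_mul, zero_pow hd, zero_mul] at h2
  have hG0 : π G ≠ 0 := by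
    intro h0
    have hunit : IsUnit (π F) := hrel dvd_rfl (h0 ▸ dvd_zero _)
    exact (hunit.map (eval (0 : Fin 2 → K))).ne_zero hπF0
  have hL0 : (linearForm ℓ : MvPolynomial (Fin 3) K) ≠ 0 := by
    intro h0
    apply hℓ
    have := eval_linearForm ℓ (Pi.single 2 1)
    simpa [h0, Fin.sum_univ_three] using this.symm
  exact Ideal.mem_span_pair_of_mul_mem π.toRingHom (fun q => ⟨ι q, hπι q⟩) hL0 hker hrel hG0 hh

/-- Two transversal plane curves of degree `d` have at least `d ^ 2` common points. -/
theorem sq_le_card_of_linearIndependent_gradient [IsAlgClosed K] {ι : Type*} [Fintype ι]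
    {F G : MvPolynomial (Fin 3) K} {d : ℕ} (hd : d ≠ 0)
    (hF : F.IsHomogeneous d) (hG : G.IsHomogeneous d) (hG0 : G ≠ 0)
    (h : ∀ v : Fin 3 → K, v ≠ 0 → eval v F = 0 → eval v G = 0 →
      LinearIndependent K ![fun k => eval v (pderiv k F), fun k => eval v (pderiv k G)])
    {v : ι → Fin 3 → K} (hv0 : ∀ i, v i ≠ 0)
    (hv : ∀ w : Fin 3 → K, w ≠ 0 → eval w F = 0 → eval w G = 0 → ∃ i, ∃ c : K, w = c • v i) :
    d ^ 2 ≤ Fintype.card ι := by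
  have hrel := isRelPrime_of_linearIndependent_gradient h
  -- The extra vector, indexed by `none`, forces `ℓ 2 ≠ 0`, so that `X 2` can be eliminated.
  obtain ⟨f, hf⟩ := Module.exists_dual_forall_apply_ne_zero (K := K)
    (fun o : Option ι => o.elim (Pi.single 2 1 : Fin 3 → K) v) (by
      rintro (_ | i)
      · simp
      · exact hv0 i)
  obtain ⟨ℓ, hℓ⟩ := exists_eval_linearForm_eq f
  have hℓ2 : ℓ 2 ≠ 0 := by
    have h1 := hf none
    rw [← hℓ, eval_linearForm] at h1
    simpa [Fin.sum_univ_three] using h1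
  have hℓv : ∀ w : Fin 3 → K, w ≠ 0 → eval w F = 0 → eval w G = 0 →
      eval w (linearForm ℓ) ≠ 0 := by
    intro w hw hwF hwG
    obtain ⟨i, c, rfl⟩ := hv w hw hwF hwG
    rw [hℓ, map_smul, smul_eq_mul]
    exact mul_ne_zero (by rintro rfl; simp at hw) (hf (some i))
  have hL0 : (linearForm ℓ : MvPolynomial (Fin 3) K) ≠ 0 := by
    intro h0
    have := hf none
    rw [← hℓ, h0, map_zero] at this
    exact this rfl
  have hker : ∀ n (p : homogeneousSubmodule (Fin 3) K n), evalForms v n p = 0 →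
      p.1 ∈ Ideal.span {F, G} := by
    rintro n ⟨p, hp⟩ hp0
    have hpv : ∀ i, eval (v i) p = 0 := fun i => by
      rw [← evalForms_apply v n ⟨p, hp⟩, hp0]; rfl
    let g : Fin 3 → MvPolynomial (Fin 3) K := ![F, G, linearForm ℓ - 1]
    have hmem : p ∈ Ideal.span (Set.range g) := by
      refine mem_span_range_of_forall_eval_eq_zero g (fun w hw => ?_) p fun w hw => ?_
      all_goals
        have hwF : eval w F = 0 := hw 0
        have hwG : eval w G = 0 := hw 1
        have hwL : eval w (linearForm ℓ) = 1 := by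
          have : eval w (linearForm ℓ - 1) = 0 := hw 2
          rwa [map_sub, map_one, sub_eq_zero] at this
        have hw0 : w ≠ 0 := by
          rintro rfl
          rw [eval_linearForm] at hwL
          simp at hwL
      · have euler : ∀ {q : MvPolynomial (Fin 3) K} {m : ℕ}, q.IsHomogeneous m →
            ∑ k, w k * eval w (pderiv k q) = m * eval w q := by
          intro q m hq
          have := congrArg (eval w) hq.sum_X_mul_pderiv
          simpa using this
        have eF := euler hF
        have eG := euler hG
        have eL := euler (isHomogeneous_linearForm ℓ)
        rw [hwF] at eF
        rw [hwG] at eG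
        rw [hwL] at eL
        intro hdet
        obtain ⟨c, hc0, hc⟩ := Matrix.exists_vecMul_eq_zero_iff.2 hdet
        have hck : ∀ k, c 0 * eval w (pderiv k F) + c 1 * eval w (pderiv k G) +
            c 2 * eval w (pderiv k (linearForm ℓ)) = 0 := by
          intro k
          have := congrFun hc k
          simpa [Matrix.vecMul, dotProduct, Fin.sum_univ_three, g] using this
        simp only [Fin.sum_univ_three] at eF eG eL
        -- Pair the row relation with `w`: by Euler the gradients of `F`, `G`, `L` pair to `0`, `0`,
        -- `1`.
        have hc2 : c 2 = 0 := by
          have h0 := hck 0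
          have h1 := hck 1
          have h2 := hck 2
          linear_combination w 0 * h0 + w 1 * h1 + w 2 * h2 - c 0 * eF - c 1 * eG - c 2 * eL
        have hc01 := LinearIndependent.pair_iff.1 (h w hw0 hwF hwG) (c 0) (c 1) (by
          ext k
          simpa [hc2] using hck k)
        apply hc0
        ext k
        fin_cases k
        · exact hc01.1
        · exact hc01.2
        · exact hc2
      · obtain ⟨i, c, rfl⟩ := hv w hw0 hwF hwG
        rw [IsHomogeneous.eval_smul hp, hpv, mul_zero]
    obtain ⟨b, hb⟩ := Ideal.mem_span_range_iff_exists_fun.1 hmem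
    rw [Fin.sum_univ_three] at hb
    obtain ⟨N, hN⟩ := exists_pow_mul_mem_span_pair hF hG (isHomogeneous_linearForm ℓ) hL0 hp hb.symm
    induction N with
    | zero => simpa using hN
    | succ N ih =>
      refine ih (mem_span_pair_of_linearForm_mul_mem hd hF hℓ2 hℓv ?_)
      rwa [pow_succ', mul_assoc] at hN
  -- Degree `2 * d` suffices: only the inclusion of the kernel in the ideal is needed, not
  -- surjectivity.
  have h1 := LinearMap.finrank_range_add_finrank_ker (evalForms v (0 + d + d))
  rw [← finrank_formsInIdeal_add_sq hF hG hG0 hrel] at h1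
  have h2 : LinearMap.ker (evalForms v (0 + d + d)) ≤
      (formsInIdeal F G (0 + d + d)).comap (homogeneousSubmodule (Fin 3) K _).subtype :=
    fun p hp => mem_formsInIdeal.2 ⟨p.2, hker _ p hp⟩
  have h3 := Submodule.finrank_mono h2
  rw [(Submodule.comapSubtypeEquivOfLe (show formsInIdeal F G (0 + d + d) ≤
    homogeneousSubmodule (Fin 3) K _ from inf_le_left)).finrank_eq] at h3
  have h4 := Submodule.finrank_le (LinearMap.range (evalForms v (0 + d + d)))
  rw [Module.finrank_fintype_fun_eq_card] at h4
  omega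

end MvPolynomial

/-! ### Bézout for projective points -/

namespace PlaneCurve

variable {d : ℕ} {C C' : PlaneCurve d}

theorem MeetsTransversally.card_le_sq (h : C.MeetsTransversally C') {ι : Type*} [Fintype ι]
    {P : ι → ℙ ℂ (Fin 3 → ℂ)} (hP : Function.Injective P)
    (hPC : ∀ i, P i ∈ C.points ∩ C'.points) : Fintype.card ι ≤ d ^ 2 := by
  refine card_le_sq_of_isRelPrime C.isHomogeneous C'.isHomogeneous C'.ne_zero
    (isRelPrime_of_linearIndependent_gradient h) (v := fun i => (P i).rep)
    (fun i => (P i).rep_nonzero) (fun i j hij => ?_) (fun i => (hPC i).1) fun i => (hPC i).2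
  have h1 := (Projectivization.independent_iff).1
    ((Projectivization.independent_pair_iff_ne (P i) (P j)).2 (hP.ne hij))
  have h2 : Projectivization.rep ∘ ![P i, P j] = ![(P i).rep, (P j).rep] := by
    ext1 k
    fin_cases k <;> rfl
  rwa [h2] at h1

theorem MeetsTransversally.finite_inter (h : C.MeetsTransversally C') :
    (C.points ∩ C'.points).Finite := by
  by_contra hinf
  obtain ⟨t, ht, hcard⟩ := Set.Infinite.exists_subset_card_eq hinf (d ^ 2 + 1)
  have h1 := h.card_le_sq (P := fun x : t => x.1) Subtype.val_injective fun x => ht x.2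
  rw [Fintype.card_coe, hcard] at h1
  omega

/-- Bézout's theorem for two transversal plane curves of the same degree. -/
theorem MeetsTransversally.ncard_inter (h : C.MeetsTransversally C') (hd : d ≠ 0) :
    (C.points ∩ C'.points).ncard = d ^ 2 := by
  have := h.finite_inter.fintype
  rw [← Nat.card_coe_set_eq, Nat.card_eq_fintype_card]
  refine le_antisymm (h.card_le_sq Subtype.val_injective fun x => x.2) ?_
  refine sq_le_card_of_linearIndependent_gradient hd C.isHomogeneous C'.isHomogeneous C'.ne_zero h
    (v := fun P : ↥(C.points ∩ C'.points) => P.1.rep) (fun P => P.1.rep_nonzero)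
    fun w hw hw1 hw2 => ?_
  refine ⟨⟨Projectivization.mk ℂ w hw, (C.mk_mem_points w hw).2 hw1,
    (C'.mk_mem_points w hw).2 hw2⟩, ?_⟩
  obtain ⟨a, ha⟩ := Projectivization.exists_smul_eq_mk_rep ℂ w hw
  refine ⟨((a⁻¹ : ℂˣ) : ℂ), ?_⟩
  change w = (a⁻¹ : ℂˣ) • (Projectivization.mk ℂ w hw).rep
  rw [← ha, inv_smul_smul]

end PlaneCurve

/-! ### Fisher's inequality -/

/-- Fisher's inequality for sets of varying size whose pairwise intersections all have `l`
elements. -/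
theorem card_le_card_of_card_inter_eq {ι α : Type*} [Fintype ι] [Fintype α] [DecidableEq α]
    (A : ι → Finset α) (l : ℕ) (hA : ∀ i, l < (A i).card)
    (hAA : ∀ i j, i ≠ j → (A i ∩ A j).card = l) : Fintype.card ι ≤ Fintype.card α := by
  classical
  let w : ι → α → ℝ := fun i x => if x ∈ A i then 1 else 0
  have hw : ∀ i j, ∑ x, w i x * w j x = (A i ∩ A j).card := by
    intro i j
    rw [Finset.card_eq_sum_ones, Nat.cast_sum, ← Finset.sum_subset (Finset.subset_univ (A i ∩ A j))]
    · refine Finset.sum_congr rfl fun x hx => ?_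
      rw [Finset.mem_inter] at hx
      simp [w, hx.1, hx.2]
    · intro x _ hx
      rw [Finset.mem_inter, not_and_or] at hx
      rcases hx with hx | hx <;> simp [w, hx]
  have hli : LinearIndependent ℝ w := by
    rw [Fintype.linearIndependent_iff]
    intro c hc
    have h0 : ∀ x, ∑ i, c i * w i x = 0 := fun x => by
      have := congrFun hc x
      simpa using this
    have h1 : ∀ i, ∑ j, c j * ((A i ∩ A j).card : ℝ) = 0 := by
      intro i
      simp_rw [← hw, Finset.mul_sum]
      rw [Finset.sum_comm]
      refine Finset.sum_eq_zero fun x _ => ?_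
      have h2 : ∑ j, c j * (w i x * w j x) = w i x * ∑ j, c j * w j x := by
        rw [Finset.mul_sum]
        exact Finset.sum_congr rfl fun j _ => by ring
      rw [h2, h0, mul_zero]
    -- The Gram matrix is `l` times the all-ones matrix plus a positive diagonal, hence positive
    -- definite.
    have h2 : ∀ i, l * ∑ j, c j + ((A i).card - l) * c i = 0 := by
      intro i
      rw [← h1 i, Finset.mul_sum, ← Finset.add_sum_erase _ _ (Finset.mem_univ i),
        ← Finset.add_sum_erase _ (fun j => c j * ((A i ∩ A j).card : ℝ)) (Finset.mem_univ i),
        Finset.inter_self]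
      have : ∑ j ∈ Finset.univ.erase i, c j * ((A i ∩ A j).card : ℝ) =
          ∑ j ∈ Finset.univ.erase i, (l : ℝ) * c j :=
        Finset.sum_congr rfl fun j hj => by
          rw [hAA i j (Finset.ne_of_mem_erase hj).symm, mul_comm]
      rw [this]
      ring
    have h3 : (l : ℝ) * (∑ j, c j) ^ 2 + ∑ i, ((A i).card - l) * c i ^ 2 = 0 := by
      have : ∑ i, c i * (l * ∑ j, c j + ((A i).card - l) * c i) = 0 :=
        Finset.sum_eq_zero fun i _ => by rw [h2, mul_zero]
      rw [← this]
      simp_rw [mul_add, Finset.sum_add_distrib, ← Finset.sum_mul]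
      congr 1
      · ring
      · exact Finset.sum_congr rfl fun i _ => by ring
    have hpos : ∀ i, (0 : ℝ) < (A i).card - l := fun i => sub_pos.2 (by exact_mod_cast hA i)
    have hnn : ∀ i ∈ Finset.univ, 0 ≤ ((A i).card - (l : ℝ)) * c i ^ 2 := fun i _ =>
      mul_nonneg (hpos i).le (sq_nonneg _)
    have h4 : ∑ i, ((A i).card - (l : ℝ)) * c i ^ 2 = 0 := by
      have := mul_nonneg (Nat.cast_nonneg (α := ℝ) l) (sq_nonneg (∑ j, c j))
      exact le_antisymm (by linarith) (Finset.sum_nonneg hnn)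
    intro i
    have h5 := (Finset.sum_eq_zero_iff_of_nonneg hnn).1 h4 i (Finset.mem_univ i)
    simpa [(hpos i).ne'] using h5
  simpa using hli.fintype_card_le_finrank

/-! ### The arrangement -/

theorem mainTheorem4 (d τ : ℕ) (hd : 1 ≤ d) (C : Fin τ → PlaneCurve d)
    (hC : IsTransversalArrangement C) (ht : PlaneArrangement.numFold C τ = 0) :
    τ ≤ PlaneArrangement.numSing C := by
  classical
  have hd0 : d ≠ 0 := by omega
  have hτ := hC.two_le
  have hne : ∀ i : Fin τ, ∃ j, i ≠ j := fun i => by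
    have : Nontrivial (Fin τ) := Fin.nontrivial_iff_two_le.2 hτ
    obtain ⟨j, hj⟩ := exists_ne i
    exact ⟨j, hj.symm⟩
  have hsing : (PlaneArrangement.sing C).Finite := by
    have : PlaneArrangement.sing C ⊆ ⋃ i, ⋃ j, ⋃ _ : i ≠ j, (C i).points ∩ (C j).points := by
      rintro P ⟨i, j, hij, hi, hj⟩
      simp only [Set.mem_iUnion]
      exact ⟨i, j, hij, hi, hj⟩
    refine Set.Finite.subset ?_ this
    exact Set.finite_iUnion fun i => Set.finite_iUnion fun j => Set.finite_iUnion fun hij =>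
      (hC.transversal i j hij).finite_inter
  have hinter_sub : ∀ i j, i ≠ j → (C i).points ∩ (C j).points ⊆ PlaneArrangement.sing C :=
    fun i j hij P hP => ⟨i, j, hij, hP.1, hP.2⟩
  have hnot : ∀ P, ∃ i, P ∉ (C i).points := by
    by_contra! hall
    obtain ⟨P, hP⟩ := hall
    -- Finiteness matters: `ncard` is also `0` on infinite sets.
    have hfin : {P | PlaneArrangement.multiplicity C P = τ}.Finite := by
      refine hsing.subset fun Q hQ => ?_
      have hQ' : ({i | Q ∈ (C i).points} : Set (Fin τ)).ncard = τ := hQ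
      have huniv : ({i | Q ∈ (C i).points} : Set (Fin τ)) = Set.univ := by
        rw [Set.eq_univ_iff_ncard, hQ', Nat.card_fin]
      have hQC : ∀ i, Q ∈ (C i).points := fun i => (huniv ▸ Set.mem_univ i :)
      obtain ⟨j, hj⟩ := hne ⟨0, by omega⟩
      exact ⟨_, j, hj, hQC _, hQC _⟩
    have hmem : P ∈ {P | PlaneArrangement.multiplicity C P = τ} := by
      change ({i | P ∈ (C i).points} : Set (Fin τ)).ncard = τ
      have huniv : ({i | P ∈ (C i).points} : Set (Fin τ)) = Set.univ :=
        Set.eq_univ_of_forall hP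
      rw [huniv, Set.ncard_univ, Nat.card_fin]
    rw [PlaneArrangement.numFold, Set.ncard_eq_zero hfin] at ht
    exact (ht ▸ hmem :)
  have := hsing.fintype
  let A : Fin τ → Finset (PlaneArrangement.sing C) := fun i =>
    Finset.univ.filter fun P => P.1 ∈ (C i).points
  have hAA : ∀ i j, i ≠ j → (A i ∩ A j).card = d ^ 2 := by
    intro i j hij
    rw [← (hC.transversal i j hij).ncard_inter hd0, ← Set.ncard_coe_finset,
      ← Set.ncard_image_of_injective _ Subtype.val_injective]
    congr 1
    ext P
    constructor
    · rintro ⟨Q, hQ, rfl⟩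
      simpa [A] using hQ
    · intro hP
      exact ⟨⟨P, hinter_sub i j hij hP⟩, by simpa [A] using hP, rfl⟩
  have hA : ∀ i, d ^ 2 < (A i).card := by
    intro i
    by_contra! hle
    have hsub : ∀ j, A i ⊆ A j := by
      intro j
      by_cases hij : i = j
      · rw [hij]
      · have := Finset.eq_of_subset_of_card_le (Finset.inter_subset_left (s₁ := A i) (s₂ := A j))
          (by rw [hAA i j hij]; exact hle)
        exact Finset.inter_eq_left.1 this
    obtain ⟨j, hij⟩ := hne i
    obtain ⟨P, hP⟩ : (A i).Nonempty := by
      have h1 : (A i ∩ A j).Nonempty := by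
        rw [← Finset.card_pos, hAA i j hij]
        positivity
      exact h1.mono Finset.inter_subset_left
    obtain ⟨k, hk⟩ := hnot P.1
    exact hk (Finset.mem_filter.1 (hsub k hP)).2
  have := card_le_card_of_card_inter_eq A (d ^ 2) hA hAA
  rwa [Fintype.card_fin, ← Nat.card_eq_fintype_card, Nat.card_coe_set_eq] at this
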